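/- Let $n\ge 2$ and let $d$ be the nilpotent endomorphism $e_1\mapsto e_2\mapsto\cdots\mapsto e_n\mapsto 0$ of $\mathbb{R}^n$. Let $F_n$ be the simply connected real Lie group whose Lie algebra has a basis $e_0,e_1,\dots,e_n$ with $[e_0,e_i]=e_{i+1}$ for $1\le i<n$ and all other brackets zero; it is the manifold $\mathbb{R}^n\times\mathbb{R}$ with the product $(v,t)(v',t')=(v+\exp(td)v',\,t+t')$. Put $H_n=\mathbb{R}^n\times\{0\}$. Let $\Gamma_0$ be the subgroup of $F_n$ generated by $(e_1,0)$ and $(0,1)$; it is isomorphic to $\mathbb{Z}^n\rtimes\mathbb{Z}$ with the generator of $\mathbb{Z}$ acting by $I+E_{2,1}+E_{3,2}+\cdots+E_{n,n-1}$. A lattice in a topological group $G$ is a discrete subgroup $\Gamma$ such that $G/\Gamma$ carries a nonzero finite $G$-invariant Borel measure. Let $\Gamma$ be a lattice in $F_n$. Then there is a maximal abelian normal subgroup $H$ of $F_n$, isomorphic to $\mathbb{R}^n$ as a topological group and equal to the kernel of a continuous surjective homomorphism $F_n\to\mathbb{R}$, with the following properties. (a) If $n\ge 3$, then $H=H_n$,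 and $H$ contains every abelian normal subgroup of $F_n$. If $n=2$ and $\Gamma$ is commensurable with $\Gamma_0$ (that is, $\Gamma\cap\Gamma_0$ has finite index in both), then also $H=H_n$. (b) $L=\Gamma\cap H$ is a lattice in $H$. (c) There are an ordered basis $(f_1,\dots,f_n)$ of the group $L$ (so $L\cong\mathbb{Z}^n$), integers $a_{kl}$ for $n\ge k>l\ge 1$, and an isomorphism from $\Gamma$ to the semidirect product $L\rtimes\mathbb{Z}$ that restricts to the identity on $L$, where the generator $1\in\mathbb{Z}$ acts on $L$ by the automorphism whose matrix in the basis $(f_1,\dots,f_n)$ is the lower unipotent matrix $g(1)=I_n+\sum_{k>l}a_{kl}E_{k,l}$. -/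

import Mathlib

open scoped Manifold ContDiff

noncomputable section

/-- A lattice in a topological group `G`: a discrete subgroup `Γ` such that `G ⧸ Γ` carries a
nonzero finite `G`-invariant Borel measure. -/
def IsGroupLattice {G : Type*} [Group G] [TopologicalSpace G] [IsTopologicalGroup G]
    (Γ : Subgroup G) : Prop :=
  DiscreteTopology Γ ∧
    letI : MeasurableSpace (G ⧸ Γ) := borel (G ⧸ Γ)
    ∃ μ : MeasureTheory.Measure (G ⧸ Γ),
      MeasureTheory.IsFiniteMeasure μ ∧ μ ≠ 0 ∧ ∀ g : G, μ.map (fun x => g • x) = μ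

namespace Filiform

/-- The principal nilpotent endomorphism `e₁ ↦ e₂ ↦ ⋯ ↦ eₙ ↦ 0` of `ℝⁿ`; this is the matrix
`E₂₁ + E₃₂ + ⋯ + Eₙ,ₙ₋₁`, with rows and columns indexed from `0`. -/
def shift (n : ℕ) : Matrix (Fin n) (Fin n) ℝ :=
  Matrix.of fun i j => if (i : ℕ) = (j : ℕ) + 1 then 1 else 0

/-- The one-parameter group `t ↦ exp (t d)` of matrices, with `d` the principal nilpotent. -/
def flow (n : ℕ) (t : ℝ) : Matrix (Fin n) (Fin n) ℝ :=
  NormedSpace.exp (t • shift n)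

theorem flow_zero (n : ℕ) : flow n 0 = 1 := by
  simp [flow]

theorem flow_add (n : ℕ) (s t : ℝ) : flow n (s + t) = flow n s * flow n t := by
  rw [flow, add_smul]
  exact Matrix.exp_add_of_commute _ _ (((Commute.refl (shift n)).smul_left s).smul_right t)

end Filiform

/-- The simply connected Lie group `F_n` whose Lie algebra has a basis `e₀, e₁, …, eₙ` with
`[e₀, eᵢ] = eᵢ₊₁` for `1 ≤ i < n` and all other brackets zero: it is the manifold `ℝⁿ × ℝ` with
the product `(v, t) (v', t') = (v + exp (t d) v', t + t')`. -/
def Filiform (n : ℕ) : Type := (Fin n → ℝ) × ℝ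

namespace Filiform

variable {n : ℕ}

instance : TopologicalSpace (Filiform n) := inferInstanceAs (TopologicalSpace ((Fin n → ℝ) × ℝ))

instance : ChartedSpace ((Fin n → ℝ) × ℝ) (Filiform n) :=
  inferInstanceAs (ChartedSpace ((Fin n → ℝ) × ℝ) ((Fin n → ℝ) × ℝ))

instance : IsManifold 𝓘(ℝ, (Fin n → ℝ) × ℝ) ω (Filiform n) :=
  inferInstanceAs (IsManifold 𝓘(ℝ, (Fin n → ℝ) × ℝ) ω ((Fin n → ℝ) × ℝ))

instance : Mul (Filiform n) := ⟨fun x y => (x.1 + (flow n x.2).mulVec y.1, x.2 + y.2)⟩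

instance : One (Filiform n) := ⟨((0 : Fin n → ℝ), (0 : ℝ))⟩

instance : Inv (Filiform n) := ⟨fun x => (-(flow n (-x.2)).mulVec x.1, -x.2)⟩

theorem fst_mul (x y : Filiform n) : (x * y).1 = x.1 + (flow n x.2).mulVec y.1 := rfl

theorem snd_mul (x y : Filiform n) : (x * y).2 = x.2 + y.2 := rfl

theorem fst_one : (1 : Filiform n).1 = 0 := rfl

theorem snd_one : (1 : Filiform n).2 = 0 := rfl

theorem fst_inv (x : Filiform n) : x⁻¹.1 = -(flow n (-x.2)).mulVec x.1 := rfl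

theorem snd_inv (x : Filiform n) : x⁻¹.2 = -x.2 := rfl

instance : Group (Filiform n) :=
  Group.ofLeftAxioms
    (fun x y z => by
      apply Prod.ext
      · simp only [fst_mul, snd_mul, flow_add, Matrix.mulVec_add, Matrix.mulVec_mulVec, add_assoc]
      · simp only [snd_mul, add_assoc])
    (fun x => by
      apply Prod.ext
      · simp [fst_mul, fst_one, snd_one, flow_zero]
      · simp [snd_mul, snd_one])
    (fun x => by
      apply Prod.ext
      · simp [fst_mul, fst_inv, snd_inv, fst_one]
      · simp [snd_mul, snd_inv, snd_one])

theorem hasDerivAt_flow (n : ℕ) (i j : Fin n) (t : ℝ) :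
    HasDerivAt (fun s => flow n s i j) ((flow n t * shift n) i j) t := by
  let _ : NormedRing (Matrix (Fin n) (Fin n) ℝ) := Matrix.linftyOpNormedRing
  let _ : NormedAlgebra ℝ (Matrix (Fin n) (Fin n) ℝ) := Matrix.linftyOpNormedAlgebra
  let L : Matrix (Fin n) (Fin n) ℝ →L[ℝ] ℝ :=
    LinearMap.toContinuousLinearMap (Matrix.entryLinearMap ℝ ℝ i j)
  exact L.hasFDerivAt.comp_hasDerivAt t (hasDerivAt_exp_smul_const (𝕂 := ℝ) (shift n) t)

theorem contDiff_flow (n : ℕ) (i j : Fin n) : ContDiff ℝ ω (fun t => flow n t i j) := by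
  let _ : NormedRing (Matrix (Fin n) (Fin n) ℝ) := Matrix.linftyOpNormedRing
  let _ : NormedAlgebra ℝ (Matrix (Fin n) (Fin n) ℝ) := Matrix.linftyOpNormedAlgebra
  have h : ContDiff ℝ ω (NormedSpace.exp : Matrix (Fin n) (Fin n) ℝ → _) :=
    AnalyticOnNhd.contDiff fun x _ => NormedSpace.exp_analytic (𝕂 := ℝ) x
  let L : Matrix (Fin n) (Fin n) ℝ →L[ℝ] ℝ :=
    LinearMap.toContinuousLinearMap (Matrix.entryLinearMap ℝ ℝ i j)
  exact L.contDiff.comp (h.comp (contDiff_id.smul contDiff_const))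

theorem contDiff_flow_mulVec (n : ℕ) :
    ContDiff ℝ ω (fun p : ℝ × (Fin n → ℝ) => (flow n p.1).mulVec p.2) := by
  rw [contDiff_pi]
  intro i
  simp only [Matrix.mulVec, dotProduct]
  exact ContDiff.sum fun j _ =>
    ((contDiff_flow n i j).comp contDiff_fst).mul ((contDiff_apply ℝ ℝ j).comp contDiff_snd)

instance : LieGroup 𝓘(ℝ, (Fin n → ℝ) × ℝ) ω (Filiform n) where
  contMDiff_mul := by
    have h : ContDiff ℝ ω
        (fun p : ((Fin n → ℝ) × ℝ) × ((Fin n → ℝ) × ℝ) =>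
          (p.1.1 + (flow n p.1.2).mulVec p.2.1, p.1.2 + p.2.2)) :=
      ((contDiff_fst.fst).add ((contDiff_flow_mulVec n).comp
        ((contDiff_fst.snd).prodMk (contDiff_snd.fst)))).prodMk
        ((contDiff_fst.snd).add (contDiff_snd.snd))
    have h' := h.contMDiff
    rw [modelWithCornersSelf_prod (E := (Fin n → ℝ) × ℝ) (F := (Fin n → ℝ) × ℝ),
      ← chartedSpaceSelf_prod] at h'
    exact h'
  contMDiff_inv := by
    have h : ContDiff ℝ ω
        (fun p : (Fin n → ℝ) × ℝ => (-(flow n (-p.2)).mulVec p.1, -p.2)) :=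
      (((contDiff_flow_mulVec n).comp ((contDiff_snd.neg).prodMk contDiff_fst)).neg).prodMk
        contDiff_snd.neg
    exact h.contMDiff

instance : IsTopologicalGroup (Filiform n) :=
  topologicalGroup_of_lieGroup 𝓘(ℝ, (Fin n → ℝ) × ℝ) ω

instance : SimplyConnectedSpace (Filiform n) :=
  inferInstanceAs (SimplyConnectedSpace ((Fin n → ℝ) × ℝ))

theorem mulInvariantVectorField_eq
    (v : GroupLieAlgebra 𝓘(ℝ, (Fin n → ℝ) × ℝ) (Filiform n)) (g : Filiform n) :
    mulInvariantVectorField v g =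
      (((flow n g.2).mulVec (show (Fin n → ℝ) × ℝ from v).1,
        (show (Fin n → ℝ) × ℝ from v).2) : (Fin n → ℝ) × ℝ) := by
  let L : (Fin n → ℝ) × ℝ →L[ℝ] (Fin n → ℝ) × ℝ :=
    (LinearMap.toContinuousLinearMap (Matrix.mulVecLin (flow n g.2))).prodMap
      (ContinuousLinearMap.id ℝ ℝ)
  have h : HasFDerivAt (fun y : (Fin n → ℝ) × ℝ =>
      ((g.1 + (flow n g.2).mulVec y.1, g.2 + y.2) : (Fin n → ℝ) × ℝ)) L (0, 0) := by
    exact (L.hasFDerivAt (x := (0, 0))).const_add ((g.1, g.2) : (Fin n → ℝ) × ℝ)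
  have h' := h.hasMFDerivAt.mfderiv
  exact congrArg (fun T => T (show (Fin n → ℝ) × ℝ from v)) h'

theorem hasFDerivAt_mulInvariantVectorField (v : (Fin n → ℝ) × ℝ) :
    HasFDerivAt (fun g : (Fin n → ℝ) × ℝ => (((flow n g.2).mulVec v.1, v.2) : (Fin n → ℝ) × ℝ))
      ((ContinuousLinearMap.snd ℝ (Fin n → ℝ) ℝ).smulRight
        (((shift n).mulVec v.1, 0) : (Fin n → ℝ) × ℝ)) (0, 0) := by
  have h : HasDerivAt (fun t : ℝ => (((flow n t).mulVec v.1, v.2) : (Fin n → ℝ) × ℝ))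
      (((shift n).mulVec v.1, 0) : (Fin n → ℝ) × ℝ) 0 := by
    refine HasDerivAt.prodMk ?_ (hasDerivAt_const _ _)
    rw [hasDerivAt_pi]
    intro i
    simp only [Matrix.mulVec, dotProduct]
    refine HasDerivAt.fun_sum fun j _ => ?_
    have := (hasDerivAt_flow n i j 0).mul_const (v.1 j)
    rwa [flow_zero, one_mul] at this
  exact h.hasFDerivAt.comp ((0, 0) : (Fin n → ℝ) × ℝ)
    (ContinuousLinearMap.snd ℝ (Fin n → ℝ) ℝ).hasFDerivAt

/-- The Lie algebra of `Filiform n`: with `e₀ = (0, 1)` and `eᵢ = (eᵢ, 0)` this says that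
`[e₀, eᵢ] = d eᵢ`, which is `eᵢ₊₁` for `i < n` and `0` for `i = n`, and `[eᵢ, eⱼ] = 0`. -/
theorem lie_eq (u w : Fin n → ℝ) (s r : ℝ) :
    (⁅(show GroupLieAlgebra 𝓘(ℝ, (Fin n → ℝ) × ℝ) (Filiform n) from (u, s)),
      (show GroupLieAlgebra 𝓘(ℝ, (Fin n → ℝ) × ℝ) (Filiform n) from (w, r))⁆ :
        GroupLieAlgebra 𝓘(ℝ, (Fin n → ℝ) × ℝ) (Filiform n)) =
      ((s • (shift n).mulVec w - r • (shift n).mulVec u, 0) : (Fin n → ℝ) × ℝ) := by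
  have key : ∀ V W : (Fin n → ℝ) × ℝ → (Fin n → ℝ) × ℝ,
      (VectorField.mlieBracket 𝓘(ℝ, (Fin n → ℝ) × ℝ) V W (0, 0) : (Fin n → ℝ) × ℝ) =
        fderiv ℝ W (0, 0) (V (0, 0)) - fderiv ℝ V (0, 0) (W (0, 0)) := fun V W =>
    (congrFun (VectorField.mlieBracketWithin_eq_lieBracketWithin (𝕜 := ℝ) (V := V) (W := W)
      (s := Set.univ)) (0, 0)).trans (congrFun VectorField.lieBracketWithin_univ (0, 0))
  let f : (Fin n → ℝ) × ℝ → (Fin n → ℝ) × ℝ → (Fin n → ℝ) × ℝ :=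
    fun v g => ((flow n g.2).mulVec v.1, v.2)
  have hv : ∀ v : GroupLieAlgebra 𝓘(ℝ, (Fin n → ℝ) × ℝ) (Filiform n),
      mulInvariantVectorField v = f v :=
    fun v => funext fun g => mulInvariantVectorField_eq v g
  rw [GroupLieAlgebra.bracket_def, hv, hv]
  refine (key (f (u, s)) (f (w, r))).trans ?_
  rw [(hasFDerivAt_mulInvariantVectorField (u, s)).fderiv,
    (hasFDerivAt_mulInvariantVectorField (w, r)).fderiv]
  exact Prod.ext (by simp [f]) (by simp [f])

/-- The normal abelian subgroup `H_n = ℝⁿ × {0}` of codimension one. -/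
def horizontal (n : ℕ) : Subgroup (Filiform n) where
  carrier := {x | x.2 = 0}
  one_mem' := snd_one
  mul_mem' {x y} hx hy := by
    simp only [Set.mem_ofPred_eq] at hx hy ⊢
    rw [snd_mul, hx, hy, add_zero]
  inv_mem' {x} hx := by
    simp only [Set.mem_ofPred_eq] at hx ⊢
    rw [snd_inv, hx, neg_zero]

/-- The standard integer lattice `Γ₀`: the subgroup generated by `(e₁, 0)` and `(0, 1)`. With
`g = exp d`, its elements are `(∑ᵢ aᵢ (g - 1)ⁱ⁻¹ e₁, k)` for integers `a₁, …, aₙ, k`, so that in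
the basis `(g - 1)ⁱ⁻¹ e₁` of `ℝⁿ` it is `ℤⁿ ⋊ ℤ` with `ℤ` acting through the powers of
`I + E₂₁ + E₃₂ + ⋯ + Eₙ,ₙ₋₁`. -/
def integerLattice (n : ℕ) : Subgroup (Filiform n) :=
  Subgroup.closure
    {((fun i : Fin n => if (i : ℕ) = 0 then (1 : ℝ) else 0), (0 : ℝ)),
      ((0 : Fin n → ℝ), (1 : ℝ))}

end Filiform

end

/-! A lattice Γ cannot lie in the kernel of a continuous surjection onto ℝ: its invariant measure
would push forward to a finite nonzero translation-invariant measure on ℝ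
(`IsGroupLattice.not_le_ker`). Hence the image of Γ in the abelianization plane, with coordinates
(v₁, t), contains two independent vectors (`exists_noncollinear`).

The main point is to find (v, 0) in Γ with v₁ ≠ 0. For n ≥ 3, the commutator of two elements with
independent images is a horizontal vector on which exp(td) still acts nontrivially. Discreteness
then makes the t-coordinates of Γ cyclic, and if all horizontal vectors of Γ had v₁ = 0, the image
of Γ in the plane would lie on a line (`exists_mem_vectors`). Commensurability with Γ₀ supplies such
a v directly. In the remaining case n = 2, an automorphism of the Heisenberg group moves an element
of Γ into that position (`exists_automorphism_two`), and H is the preimage of H_n.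

Given such a v, powers of exp(td) - 1 produce vectors of L with leading coordinate in every
position. Leading coordinates of L at each position form a discrete subgroup of ℝ, so choosing
generators yields a triangular ℤ-basis (`exists_adapted_basis`, `exists_intComb_eq`). In it exp(td)
is lower unipotent and integral, L is cocompact in H, and an element of least nonzero height splits
Γ over L (`structure_of_discrete`). -/

noncomputable section

namespace Filiform

/-! ### The matrices exp(td) and the flag they preserve. -/

/-- The matrix entries of `exp (t d)`. -/
theorem flow_apply (n : ℕ) (t : ℝ) (i j : Fin n) :
    flow n t i j =
      if (j : ℕ) ≤ i then t ^ ((i : ℕ) - j) / (((i : ℕ) - j).factorial : ℝ) else 0 := by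
  -- Induction on the columns from right to left: the derivative of column j is column j + 1, and
  -- the derivative of the last column is zero.
  suffices h : ∀ m : ℕ, ∀ j : Fin n, (j : ℕ) + m + 1 = n → ∀ t, flow n t i j =
      if (j : ℕ) ≤ i then t ^ ((i : ℕ) - j) / (((i : ℕ) - j).factorial : ℝ) else 0 from
    h (n - 1 - j) j (by omega) t
  have ext_of_deriv : ∀ f g g' : ℝ → ℝ, (∀ t, HasDerivAt f (g' t) t) →
      (∀ t, HasDerivAt g (g' t) t) → f 0 = g 0 → ∀ t, f t = g t := by
    intro f g g' hf hg h0 t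
    have hd : ∀ t, HasDerivAt (fun s => f s - g s) 0 t := fun t => by
      simpa using (hf t).fun_sub (hg t)
    have := is_const_of_deriv_eq_zero (fun t => (hd t).differentiableAt)
      (fun t => (hd t).deriv) t 0
    simp only [h0, sub_self] at this
    linarith
  have hzero : ∀ j : Fin n, flow n 0 i j =
      if (j : ℕ) ≤ i then (0 : ℝ) ^ ((i : ℕ) - j) / (((i : ℕ) - j).factorial : ℝ) else 0 := by
    intro j
    rw [flow_zero, Matrix.one_apply]
    rcases lt_trichotomy (i : ℕ) (j : ℕ) with hij | hij | hij
    · rw [if_neg (by omega), if_neg (by omega)]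
    · simp [Fin.ext_iff, hij]
    · rw [if_neg (by rw [Fin.ext_iff]; omega), if_pos hij.le, zero_pow (by omega), zero_div]
  have hpow : ∀ (k : ℕ) (t : ℝ), HasDerivAt (fun s : ℝ => s ^ (k + 1) / ((k + 1).factorial : ℝ))
      (t ^ k / (k.factorial : ℝ)) t := by
    intro k t
    have h := (hasDerivAt_pow (k + 1) t).div_const ((k + 1).factorial : ℝ)
    refine h.congr_deriv ?_
    rw [Nat.factorial_succ]
    push_cast
    have : (k.factorial : ℝ) ≠ 0 := by exact_mod_cast k.factorial_ne_zero
    have : (k : ℝ) + 1 ≠ 0 := by positivity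
    field_simp
  intro m
  induction m with
  | zero =>
    intro j hj
    refine ext_of_deriv _ _ (fun _ => 0) (fun t => ?_) (fun t => ?_) (hzero j)
    · convert hasDerivAt_flow n i j t using 1
      rw [Matrix.mul_apply]
      refine (Finset.sum_eq_zero fun k _ => ?_).symm
      simp only [shift, Matrix.of_apply]
      rw [if_neg (by omega), mul_zero]
    · have h0 : (i : ℕ) - j = 0 := by omega
      simp only [h0, pow_zero]
      exact hasDerivAt_const t _
  | succ m ih =>
    intro j hj
    have hj1 : (j : ℕ) + 1 < n := by omega
    refine ext_of_deriv _ _ (fun t => flow n t i ⟨j + 1, hj1⟩) (fun t => ?_) (fun t => ?_) (hzero j)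
    · convert hasDerivAt_flow n i j t using 1
      rw [Matrix.mul_apply, Finset.sum_eq_single ⟨j + 1, hj1⟩]
      · simp [shift]
      · intro k _ hk
        simp only [shift, Matrix.of_apply]
        rw [if_neg (by rw [Ne, Fin.ext_iff] at hk; exact hk), mul_zero]
      · simp
    · rw [ih ⟨j + 1, hj1⟩ (by simp only; omega)]
      simp only
      rcases lt_trichotomy (i : ℕ) (j : ℕ) with hij | hij | hij
      · rw [if_neg (by omega)]
        simp only [if_neg (show ¬ (j : ℕ) ≤ i by omega)]
        exact hasDerivAt_const t 0
      · rw [if_neg (by omega)]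
        simp only [hij, le_refl, if_true, Nat.sub_self, pow_zero]
        exact hasDerivAt_const t _
      · rw [if_pos (by omega)]
        simp only [hij.le, if_true]
        obtain ⟨k, hk⟩ : ∃ k, (i : ℕ) = j + k + 1 := ⟨i - j - 1, by omega⟩
        rw [show (i : ℕ) - (j + 1) = k by omega, show (i : ℕ) - j = k + 1 by omega]
        exact hpow k t

variable {n : ℕ}

/-- The vectors whose coordinates of index less than `j` vanish. -/
def tail (n j : ℕ) : Submodule ℝ (Fin n → ℝ) where
  carrier := {v | ∀ i : Fin n, (i : ℕ) < j → v i = 0}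
  zero_mem' := fun _ _ => rfl
  add_mem' := fun hv hw i hi => by simp [hv i hi, hw i hi]
  smul_mem' := fun c v hv i hi => by simp [hv i hi]

theorem mem_tail {j : ℕ} {v : Fin n → ℝ} : v ∈ tail n j ↔ ∀ i : Fin n, (i : ℕ) < j → v i = 0 :=
  Iff.rfl

theorem tail_zero (v : Fin n → ℝ) : v ∈ tail n 0 := fun _ hi => absurd hi (Nat.not_lt_zero _)

theorem eq_zero_of_mem_tail {v : Fin n → ℝ} (h : v ∈ tail n n) : v = 0 :=
  funext fun i => h i i.2

theorem mem_tail_succ {v : Fin n → ℝ} {j : Fin n} (h : v ∈ tail n j) (hj : v j = 0) :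
    v ∈ tail n (j + 1) := by
  intro i hi
  rcases Nat.lt_succ_iff_lt_or_eq.mp hi with h' | h'
  · exact h i h'
  · rwa [Fin.ext h']

theorem flow_mulVec_apply (t : ℝ) {v : Fin n → ℝ} {j : ℕ} (hv : v ∈ tail n j) (i : Fin n)
    (hi : (i : ℕ) ≤ j) : (flow n t).mulVec v i = v i := by
  rw [Matrix.mulVec, dotProduct, Finset.sum_eq_single i]
  · simp [flow_apply]
  · intro k _ hk
    rcases lt_or_ge (k : ℕ) j with h | h
    · rw [hv k h, mul_zero]
    · rw [Ne, Fin.ext_iff] at hk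
      rw [flow_apply, if_neg (by omega), zero_mul]
  · simp

theorem flow_mulVec_apply_succ (t : ℝ) {v : Fin n → ℝ} {j : Fin n} (hv : v ∈ tail n j)
    (hj : (j : ℕ) + 1 < n) :
    (flow n t).mulVec v ⟨j + 1, hj⟩ = v ⟨j + 1, hj⟩ + t * v j := by
  rw [Matrix.mulVec, dotProduct, Finset.sum_eq_add (⟨j + 1, hj⟩ : Fin n) j]
  · simp [flow_apply]
  · simp [Fin.ext_iff]
  · intro k _ hk
    simp only [Ne, Fin.ext_iff] at hk
    rcases lt_or_ge (k : ℕ) j with h | h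
    · rw [hv k h, mul_zero]
    · rw [flow_apply, if_neg (by simp only; omega), zero_mul]
  · simp
  · simp

theorem flow_mulVec_sub_mem (t : ℝ) {v : Fin n → ℝ} {j : ℕ} (hv : v ∈ tail n j) :
    (flow n t).mulVec v - v ∈ tail n (j + 1) := by
  intro i hi
  rw [Pi.sub_apply, flow_mulVec_apply t hv i (by omega), sub_self]

theorem flow_mulVec_sub_apply (t : ℝ) {v : Fin n → ℝ} {j : Fin n} (hv : v ∈ tail n j)
    (hj : (j : ℕ) + 1 < n) :
    ((flow n t).mulVec v - v) ⟨j + 1, hj⟩ = t * v j := by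
  rw [Pi.sub_apply, flow_mulVec_apply_succ t hv, add_sub_cancel_left]

/-- Iterating `flow n t - 1` moves the leading coordinate down and multiplies it by `t`. -/
theorem iterate_flow_sub (t : ℝ) {v : Fin n → ℝ} {j : Fin n} (hv : v ∈ tail n j) (k : ℕ)
    (hk : (j : ℕ) + k < n) :
    ((fun u => (flow n t).mulVec u - u)^[k] v) ∈ tail n (j + k) ∧
      ((fun u => (flow n t).mulVec u - u)^[k] v) ⟨j + k, hk⟩ = t ^ k * v j := by
  induction k with
  | zero => simpa using hv
  | succ k ih =>
    obtain ⟨h1, h2⟩ := ih (by omega)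
    rw [Function.iterate_succ_apply']
    refine ⟨flow_mulVec_sub_mem t h1, ?_⟩
    have := flow_mulVec_sub_apply t (j := ⟨j + k, by omega⟩) h1 (by simp only; omega)
    rw [h2] at this
    rw [pow_succ', mul_assoc]
    exact this

/-! ### Group calculus and the abelian normal subgroup H_n. -/

/-- The element `(v, t)`. -/
def mk (v : Fin n → ℝ) (t : ℝ) : Filiform n := (v, t)

@[simp] theorem mk_fst (v : Fin n → ℝ) (t : ℝ) : (mk v t).1 = v := rfl
@[simp] theorem mk_snd (v : Fin n → ℝ) (t : ℝ) : (mk v t).2 = t := rfl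

@[ext] theorem ext' {x y : Filiform n} (h1 : x.1 = y.1) (h2 : x.2 = y.2) : x = y := Prod.ext h1 h2

theorem continuous_val_fst : Continuous fun x : Filiform n => x.1 :=
  continuous_fst (X := Fin n → ℝ) (Y := ℝ)

theorem continuous_val_snd : Continuous fun x : Filiform n => x.2 :=
  continuous_snd (X := Fin n → ℝ) (Y := ℝ)

theorem continuous_mk : Continuous fun p : (Fin n → ℝ) × ℝ => mk p.1 p.2 :=
  continuous_id (X := (Fin n → ℝ) × ℝ)

theorem mk_mul_mk (v w : Fin n → ℝ) (s t : ℝ) :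
    mk v s * mk w t = mk (v + (flow n s).mulVec w) (s + t) := rfl

theorem mk_zero_mul (v w : Fin n → ℝ) (t : ℝ) : mk v 0 * mk w t = mk (v + w) t := by
  rw [mk_mul_mk, flow_zero, Matrix.one_mulVec, zero_add]

theorem mk_zero_inv (v : Fin n → ℝ) : (mk v 0)⁻¹ = mk (-v) 0 := by
  apply ext'
  · simp [fst_inv, flow_zero]
  · simp [snd_inv]

/-- Two elements with the same second coordinate differ by an element of `H_n`. -/
theorem mk_mul_mk_inv (v w : Fin n → ℝ) (t : ℝ) : mk v t * (mk w t)⁻¹ = mk (v - w) 0 := by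
  rw [mul_inv_eq_iff_eq_mul, mk_zero_mul, sub_add_cancel]

theorem conj_mk_zero (x : Filiform n) (v : Fin n → ℝ) :
    x * mk v 0 * x⁻¹ = mk ((flow n x.2).mulVec v) 0 := by
  rw [mul_inv_eq_iff_eq_mul]
  apply ext'
  · simp [fst_mul, flow_zero, add_comm]
  · simp [snd_mul]

theorem commutator_eq (x y : Filiform n) :
    x * y * (y * x)⁻¹ =
      mk (((flow n x.2).mulVec y.1 - y.1) - ((flow n y.2).mulVec x.1 - x.1)) 0 := by
  have h1 : x * y = mk (x.1 + (flow n x.2).mulVec y.1) (x.2 + y.2) := rfl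
  have h2 : y * x = mk (y.1 + (flow n y.2).mulVec x.1) (x.2 + y.2) := by
    rw [add_comm x.2]; rfl
  rw [h1, h2, mk_mul_mk_inv]
  congr 1
  abel

theorem mem_horizontal {x : Filiform n} : x ∈ horizontal n ↔ x.2 = 0 := Iff.rfl

/-- The homomorphism `(v, t) ↦ t`. -/
def height (n : ℕ) : Filiform n →* Multiplicative ℝ where
  toFun x := Multiplicative.ofAdd x.2
  map_one' := rfl
  map_mul' _ _ := rfl

theorem height_apply (x : Filiform n) : height n x = Multiplicative.ofAdd x.2 := rfl

theorem continuous_height : Continuous (height n) := continuous_val_snd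

theorem height_surjective : Function.Surjective (height n) := fun t =>
  ⟨mk 0 (Multiplicative.toAdd t), rfl⟩

theorem height_ker : (height n).ker = horizontal n := by
  ext x
  rw [MonoidHom.mem_ker, mem_horizontal, height_apply]
  exact ofAdd_eq_one

theorem snd_zpow (x : Filiform n) (k : ℤ) : (x ^ k).2 = k * x.2 := by
  have := map_zpow (height n) x k
  simpa [height_apply, ← ofAdd_zsmul] using this

instance horizontal_normal : (horizontal n).Normal := height_ker (n := n) ▸ inferInstance

theorem horizontal_comm : IsMulCommutative (horizontal n) := by
  refine ⟨⟨fun x y => Subtype.ext (ext' ?_ ?_)⟩⟩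
  · have hx : x.1.2 = 0 := x.2
    have hy : y.1.2 = 0 := y.2
    simp only [Subgroup.coe_mul, fst_mul, hx, hy, flow_zero, Matrix.one_mulVec, add_comm]
  · simp only [Subgroup.coe_mul, snd_mul, add_comm]

/-- An element of height t commuting with (e₁, 0) has t = 0, because (exp(td) - 1)e₁ has second
coordinate t. -/
theorem maximal_horizontal (hn : 2 ≤ n) :
    Maximal (fun K : Subgroup (Filiform n) => K.Normal ∧ IsMulCommutative K) (horizontal n) := by
  refine ⟨⟨horizontal_normal, horizontal_comm⟩, ?_⟩
  rintro K ⟨-, hK⟩ hle x hx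
  rw [mem_horizontal]
  let v : Fin n → ℝ := Pi.single ⟨0, by omega⟩ 1
  have hv : mk v 0 ∈ K := hle rfl
  have hc : x * mk v 0 = mk v 0 * x :=
    congrArg Subtype.val (hK.is_comm.comm (⟨x, hx⟩ : K) ⟨mk v 0, hv⟩)
  have h := conj_mk_zero x v
  rw [hc, mul_inv_cancel_right] at h
  have h1 : v = (flow n x.2).mulVec v := congrArg Prod.fst h
  have h2 := flow_mulVec_sub_apply x.2 (j := ⟨0, by omega⟩) (tail_zero v) (by simp only; omega)
  rw [← h1, sub_self] at h2
  simpa [v] using h2.symm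

/-- By normality, K contains the commutator of x ∈ K with (e₁, 0), which is the vector (exp(td) -
1)e₁. As K is abelian, x fixes this vector, so (exp(td) - 1)²e₁ = 0. Its third coordinate is t²,
which forces t = 0. -/
theorem le_horizontal_of_normal_comm (hn : 3 ≤ n) (K : Subgroup (Filiform n)) (hK : K.Normal)
    (hc : IsMulCommutative K) : K ≤ horizontal n := by
  intro x hx
  rw [mem_horizontal]
  let v : Fin n → ℝ := Pi.single ⟨0, by omega⟩ 1
  let u := (flow n x.2).mulVec v - v
  have hu : mk u 0 ∈ K := by
    have h := K.mul_mem hx (hK.conj_mem _ (K.inv_mem hx) (mk v 0))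
    have h' : x * (mk v 0 * x⁻¹ * (mk v 0)⁻¹) = mk u 0 := by
      rw [← mul_assoc, ← mul_assoc, conj_mk_zero, mk_mul_mk_inv]
    rwa [h'] at h
  have hcomm : x * mk u 0 = mk u 0 * x :=
    congrArg Subtype.val (hc.is_comm.comm (⟨x, hx⟩ : K) ⟨mk u 0, hu⟩)
  have h := conj_mk_zero x u
  rw [hcomm, mul_inv_cancel_right] at h
  have h1 : u = (flow n x.2).mulVec u := congrArg Prod.fst h
  have h2 := (iterate_flow_sub x.2 (j := ⟨0, by omega⟩) (tail_zero v) 2 (by simp only; omega)).2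
  have h3 : (fun w => (flow n x.2).mulVec w - w)^[2] v = 0 := by
    change (flow n x.2).mulVec u - u = 0
    rw [← h1, sub_self]
  rw [h3] at h2
  simpa [v] using h2.symm

/-! ### Horizontal vectors and heights of a discrete subgroup. -/

/-- The vectors `v` with `(v, 0) ∈ Γ`. -/
def vectors (Γ : Subgroup (Filiform n)) : AddSubgroup (Fin n → ℝ) where
  carrier := {v | mk v 0 ∈ Γ}
  zero_mem' := Γ.one_mem
  add_mem' {v w} hv hw := by
    have := Γ.mul_mem hv hw
    rwa [mk_zero_mul] at this
  neg_mem' {v} hv := by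
    have := Γ.inv_mem hv
    rwa [mk_zero_inv] at this

theorem mem_vectors {Γ : Subgroup (Filiform n)} {v : Fin n → ℝ} :
    v ∈ vectors Γ ↔ mk v 0 ∈ Γ := Iff.rfl

theorem flow_mem_vectors {Γ : Subgroup (Filiform n)} {x : Filiform n} (hx : x ∈ Γ)
    {v : Fin n → ℝ} (hv : v ∈ vectors Γ) : (flow n x.2).mulVec v ∈ vectors Γ := by
  rw [mem_vectors, ← conj_mk_zero]
  exact Γ.mul_mem (Γ.mul_mem hx hv) (Γ.inv_mem hx)

theorem exists_norm_lt_imp_eq_zero (Γ : Subgroup (Filiform n)) [DiscreteTopology Γ] :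
    ∃ ε > 0, ∀ v ∈ vectors Γ, ‖v‖ < ε → v = 0 := by
  have h : IsOpen ({1} : Set Γ) := isOpen_discrete _
  obtain ⟨U, hU, hU1⟩ := isOpen_induced_iff.mp h
  have hc : Continuous fun v : Fin n → ℝ => mk v 0 :=
    continuous_mk.comp (continuous_id.prodMk continuous_const)
  have h0 : (fun v : Fin n → ℝ => mk v 0) ⁻¹' U ∈ nhds 0 := by
    refine (hU.preimage hc).mem_nhds ?_
    have : (1 : Γ) ∈ Subtype.val ⁻¹' U := by rw [hU1]; rfl
    exact this
  obtain ⟨ε, hε, hb⟩ := Metric.mem_nhds_iff.mp h0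
  refine ⟨ε, hε, fun v hv hlt => ?_⟩
  have hvU : mk v 0 ∈ U := hb (by simpa using hlt)
  have : (⟨mk v 0, hv⟩ : Γ) ∈ Subtype.val ⁻¹' U := hvU
  rw [hU1] at this
  exact congrArg (fun x : Γ => x.1.1) this

/-- The subgroup of `ℝ` of all second coordinates of elements of `Γ`. -/
def heights (Γ : Subgroup (Filiform n)) : AddSubgroup ℝ where
  carrier := {t | ∃ x ∈ Γ, x.2 = t}
  zero_mem' := ⟨1, Γ.one_mem, rfl⟩
  add_mem' := by
    rintro _ _ ⟨x, hx, rfl⟩ ⟨y, hy, rfl⟩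
    exact ⟨x * y, Γ.mul_mem hx hy, rfl⟩
  neg_mem' := by
    rintro _ ⟨x, hx, rfl⟩
    exact ⟨x⁻¹, Γ.inv_mem hx, rfl⟩

theorem exists_closure_of_isolated {S : AddSubgroup ℝ} {ε : ℝ} (hε : 0 < ε)
    (h : ∀ t ∈ S, |t| < ε → t = 0) : ∃ t ∈ S, ∀ s ∈ S, ∃ k : ℤ, s = k * t := by
  obtain ⟨t, ht⟩ := AddSubgroup.cyclic_of_isolated_zero (H := S) hε (by
    rw [Set.disjoint_left]
    intro s hs hs'
    have := h s hs (by rw [abs_of_pos hs'.1]; exact hs'.2)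
    exact hs'.1.ne' this)
  refine ⟨t, ht ▸ AddSubgroup.subset_closure rfl, fun s hs => ?_⟩
  rw [ht, AddSubgroup.mem_closure_singleton] at hs
  obtain ⟨k, hk⟩ := hs
  exact ⟨k, by rw [← hk, zsmul_eq_mul]⟩

/-- The heights of a discrete subgroup that acts nontrivially on a vector in it are discrete. -/
theorem exists_height_generator (Γ : Subgroup (Filiform n)) [DiscreteTopology Γ]
    {v : Fin n → ℝ} (hv : v ∈ vectors Γ) {j : Fin n} (hvj : v ∈ tail n j) (hj : v j ≠ 0)
    (hjn : (j : ℕ) + 1 < n) :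
    ∃ g ∈ Γ, ∀ x ∈ Γ, ∃ k : ℤ, x.2 = k * g.2 := by
  obtain ⟨ε, hε, hΓ⟩ := exists_norm_lt_imp_eq_zero Γ
  -- For small t the vector (exp(td) - 1)v is short, hence zero when t is a height of Γ. But its
  -- coordinate after the leading one of v is t times that leading coordinate.
  have hc : Continuous fun t : ℝ => (flow n t).mulVec v - v :=
    ((contDiff_flow_mulVec n).continuous.comp (continuous_id.prodMk continuous_const)).sub
      continuous_const
  have h0 : (fun t : ℝ => (flow n t).mulVec v - v) ⁻¹' Metric.ball 0 ε ∈ nhds 0 := by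
    refine (Metric.isOpen_ball.preimage hc).mem_nhds ?_
    simpa [flow_zero] using hε
  obtain ⟨δ, hδ, hb⟩ := Metric.mem_nhds_iff.mp h0
  obtain ⟨t, ⟨g, hg, rfl⟩, ht⟩ := exists_closure_of_isolated (S := heights Γ) hδ (by
    rintro _ ⟨x, hx, rfl⟩ hlt
    have h1 : (flow n x.2).mulVec v - v = 0 := by
      refine hΓ _ ((vectors Γ).sub_mem (flow_mem_vectors hx hv) hv) ?_
      have := hb (show x.2 ∈ Metric.ball (0 : ℝ) δ by simpa using hlt)
      simpa using this
    have h2 := flow_mulVec_sub_apply x.2 hvj hjn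
    rw [h1] at h2
    simpa [hj] using h2.symm)
  exact ⟨g, hg, fun x hx => ht _ ⟨x, hx, rfl⟩⟩

/-! ### Integral bases adapted to the flag. -/

/-- A family of vectors with leading coordinates in all positions. -/
def IsTriangular (b : Fin n → Fin n → ℝ) : Prop := ∀ j : Fin n, b j ∈ tail n j ∧ b j j ≠ 0

theorem IsTriangular.coeff_eq_zero {b : Fin n → Fin n → ℝ} (hb : IsTriangular b) {c : Fin n → ℝ}
    {j : ℕ} (h : ∑ k, c k • b k ∈ tail n j) (k : Fin n) (hk : (k : ℕ) < j) : c k = 0 := by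
  obtain ⟨m, hm⟩ : ∃ m, m = (k : ℕ) := ⟨_, rfl⟩
  induction m using Nat.strong_induction_on generalizing k with
  | _ m ih =>
    have h1 := h k hk
    rw [Finset.sum_apply, Finset.sum_eq_single k] at h1
    · simpa [(hb k).2] using h1
    · intro i _ hi
      rcases lt_or_ge (i : ℕ) k with hik | hik
      · simp [ih i (by omega) i (by omega) rfl]
      · have : (k : ℕ) < i := lt_of_le_of_ne hik (fun e => hi (Fin.ext e.symm))
        simp [mem_tail.mp (hb i).1 k this]
    · simp

theorem IsTriangular.linearIndependent {b : Fin n → Fin n → ℝ} (hb : IsTriangular b) :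
    LinearIndependent ℝ b := by
  rw [Fintype.linearIndependent_iff]
  intro c hc k
  exact hb.coeff_eq_zero (j := n) (by rw [hc]; exact Submodule.zero_mem _) k k.2

/-- The integral combinations of a family of vectors. -/
def intComb (b : Fin n → Fin n → ℝ) : (Fin n → ℤ) →+ (Fin n → ℝ) where
  toFun c := ∑ k, (c k : ℝ) • b k
  map_zero' := by simp
  map_add' c d := by simp [add_smul, Finset.sum_add_distrib]

theorem intComb_apply (b : Fin n → Fin n → ℝ) (c : Fin n → ℤ) :
    intComb b c = ∑ k, (c k : ℝ) • b k := rfl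

theorem IsTriangular.intComb_injective {b : Fin n → Fin n → ℝ} (hb : IsTriangular b) :
    Function.Injective (intComb b) := by
  rw [injective_iff_map_eq_zero]
  intro c hc
  funext k
  have h0 : ∑ k, (c k : ℝ) • b k = 0 := hc
  have := hb.coeff_eq_zero (c := fun k => (c k : ℝ)) (j := n)
    (by rw [h0]; exact Submodule.zero_mem _) k k.2
  exact_mod_cast this

/-- A discrete subgroup of `ℝⁿ` that is invariant under `exp (t d)` for some `t ≠ 0` and is not
contained in the hyperplane `v₁ = 0` has a basis adapted to the flag of the subspaces `tail n j`. -/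
theorem exists_adapted_basis {Λ : AddSubgroup (Fin n → ℝ)} {ε : ℝ} (hε : 0 < ε)
    (hΛ : ∀ v ∈ Λ, ‖v‖ < ε → v = 0) {t : ℝ} (ht : t ≠ 0)
    (hflow : ∀ v ∈ Λ, (flow n t).mulVec v ∈ Λ) (hn : 0 < n)
    {v : Fin n → ℝ} (hv : v ∈ Λ) (hv0 : v ⟨0, hn⟩ ≠ 0) :
    ∃ b : Fin n → Fin n → ℝ, IsTriangular b ∧ (∀ j, b j ∈ Λ) ∧
      ∀ j : Fin n, ∀ w ∈ Λ, w ∈ tail n (j : ℕ) → ∃ k : ℤ, w j = k * b j j := by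
  have hiter : ∀ k, ∀ w ∈ Λ, (fun u => (flow n t).mulVec u - u)^[k] w ∈ Λ := by
    intro k w hw
    induction k with
    | zero => exact hw
    | succ k ih =>
      rw [Function.iterate_succ_apply']
      exact Λ.sub_mem (hflow _ ih) ih
  have key : ∀ j : Fin n, ∃ b ∈ Λ, b ∈ tail n j ∧ b j ≠ 0 ∧
      ∀ w ∈ Λ, w ∈ tail n (j : ℕ) → ∃ k : ℤ, w j = k * b j := by
    intro j
    let S : AddSubgroup ℝ := (Λ ⊓ (tail n j).toAddSubgroup).map (Pi.evalAddMonoidHom _ j)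
    have htp : 0 < |t| ^ (n - 1 - (j : ℕ)) := by positivity
    -- Applying (exp(td) - 1)^(n-1-j) to w moves its leading coordinate to the last position,
    -- multiplied by t^(n-1-j), and kills everything else. The norm bound ε therefore becomes a
    -- lower bound on nonzero leading coordinates.
    obtain ⟨s, hs, hgen⟩ := exists_closure_of_isolated (S := S)
        (ε := ε / |t| ^ (n - 1 - (j : ℕ))) (by positivity) (by
      rintro _ ⟨w, ⟨hwΛ, hwt⟩, rfl⟩ hlt
      have hwt' : w ∈ tail n j := hwt
      change |w j| < _ at hlt
      change w j = 0
      obtain ⟨h1, h2⟩ := iterate_flow_sub t hwt' (n - 1 - j) (by omega)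
      have h3 := hΛ _ (hiter (n - 1 - j) w hwΛ) (by
        rw [pi_norm_lt_iff hε]
        intro i
        rcases lt_or_ge (i : ℕ) (j + (n - 1 - j)) with hi | hi
        · rw [h1 i hi]
          simpa using hε
        · have hi' : i = ⟨j + (n - 1 - j), by omega⟩ := Fin.ext (by simp only; omega)
          rw [hi', h2, Real.norm_eq_abs, abs_mul, abs_pow, mul_comm]
          exact (lt_div_iff₀ htp).mp hlt)
      rw [h3] at h2
      simpa [ht] using h2.symm)
    obtain ⟨b, ⟨hbΛ, hbt⟩, rfl⟩ := hs
    refine ⟨b, hbΛ, hbt, ?_, fun w hw hwt => hgen _ ⟨w, ⟨hw, hwt⟩, rfl⟩⟩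
    -- The generator is nonzero because (exp(td) - 1)^j v lies in Λ with leading coordinate t^j v₁ ≠
    -- 0.
    intro hb0
    obtain ⟨h1, h2⟩ := iterate_flow_sub t (j := ⟨0, hn⟩) (tail_zero v) j (by simp)
    have hj : (⟨(⟨0, hn⟩ : Fin n) + (j : ℕ), by simp⟩ : Fin n) = j := Fin.ext (by simp)
    obtain ⟨k, hk⟩ := hgen _ ⟨_, ⟨hiter j v hv, by simpa using h1⟩, rfl⟩
    simp only [Pi.evalAddMonoidHom_apply, hb0, mul_zero] at hk
    rw [hj, hk] at h2
    have := mul_ne_zero (pow_ne_zero j ht) hv0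
    exact this h2.symm
  choose b h1 h2 h3 h4 using key
  exact ⟨b, fun j => ⟨h2 j, h3 j⟩, h1, h4⟩

/-- Elimination down the flag: subtracting an integral multiple of `b j` clears the leading
coordinate and leaves a vector of Λ one step deeper. -/
theorem exists_intComb_eq {Λ : AddSubgroup (Fin n → ℝ)} {b : Fin n → Fin n → ℝ}
    (hb : IsTriangular b) (hbΛ : ∀ j, b j ∈ Λ)
    (hgen : ∀ j : Fin n, ∀ w ∈ Λ, w ∈ tail n (j : ℕ) → ∃ k : ℤ, w j = k * b j j)
    {w : Fin n → ℝ} (hw : w ∈ Λ) : ∃ c, intComb b c = w := by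
  suffices h : ∀ m j : ℕ, j + m = n → ∀ w ∈ Λ, w ∈ tail n j → ∃ c, intComb b c = w from
    h n 0 (zero_add n) w hw (tail_zero w)
  intro m
  induction m with
  | zero =>
    rintro j rfl w - hw
    exact ⟨0, by rw [map_zero, eq_zero_of_mem_tail hw]⟩
  | succ m ih =>
    intro j hj w hw hwt
    obtain ⟨k, hk⟩ := hgen ⟨j, by omega⟩ w hw hwt
    have hkb : intComb b (Pi.single ⟨j, by omega⟩ k) = (k : ℝ) • b ⟨j, by omega⟩ := by
      rw [intComb_apply, Finset.sum_eq_single ⟨j, by omega⟩]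
      · simp
      · intro i _ hi
        simp [hi]
      · simp
    have hmem : (k : ℝ) • b ⟨j, by omega⟩ ∈ Λ := by
      rw [Int.cast_smul_eq_zsmul]
      exact Λ.zsmul_mem (hbΛ _) k
    obtain ⟨c, hc⟩ := ih (j + 1) (by omega) (w - (k : ℝ) • b ⟨j, by omega⟩)
      (Λ.sub_mem hw hmem)
      (mem_tail_succ (j := ⟨j, by omega⟩)
        ((tail n j).sub_mem hwt ((tail n j).smul_mem _ (hb ⟨j, by omega⟩).1))
        (by simp [hk]))
    exact ⟨c + Pi.single ⟨j, by omega⟩ k, by rw [map_add, hc, hkb, sub_add_cancel]⟩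

/-- The unipotent matrix of `exp (t d)` in an adapted basis. -/
theorem exists_unipotent_matrix {Λ : AddSubgroup (Fin n → ℝ)} {b : Fin n → Fin n → ℝ}
    (hb : IsTriangular b) (hbΛ : ∀ j, b j ∈ Λ)
    (hgen : ∀ j : Fin n, ∀ w ∈ Λ, w ∈ tail n (j : ℕ) → ∃ k : ℤ, w j = k * b j j)
    {t : ℝ} (hflow : ∀ v ∈ Λ, (flow n t).mulVec v ∈ Λ) :
    ∃ A : Matrix (Fin n) (Fin n) ℤ, (∀ k, A k k = 1) ∧ (∀ k l, k < l → A k l = 0) ∧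
      ∀ c, (flow n t).mulVec (intComb b c) = intComb b (A.mulVec c) := by
  have h1 : ∀ l, ∃ c, intComb b c = (flow n t).mulVec (b l) - b l := fun l =>
    exists_intComb_eq hb hbΛ hgen (Λ.sub_mem (hflow _ (hbΛ l)) (hbΛ l))
  choose N hN using h1
  -- exp(td) - 1 moves each vector strictly down the flag, so its matrix is strictly lower
  -- triangular. `N l` is the column of index l, hence the transposed indices in the matrix below.
  have hN0 : ∀ l k : Fin n, k ≤ l → N l k = 0 := by
    intro l k hkl
    have h2 : ∑ k, (N l k : ℝ) • b k ∈ tail n (l + 1) := by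
      rw [← intComb_apply, hN]
      exact flow_mulVec_sub_mem t (hb l).1
    have := hb.coeff_eq_zero h2 k (by omega)
    exact_mod_cast this
  refine ⟨Matrix.of fun k l => (if k = l then 1 else 0) + N l k, fun k => ?_, fun k l hkl => ?_,
    fun c => ?_⟩
  · simp [hN0 k k le_rfl]
  · simp [hN0 l k hkl.le, hkl.ne]
  · have h3 : ∀ l, (flow n t).mulVec (b l) = b l + ∑ k, (N l k : ℝ) • b k := fun l => by
      rw [← intComb_apply, hN]
      abel
    rw [intComb_apply, intComb_apply, Matrix.mulVec_sum]
    simp only [Matrix.mulVec_smul, h3, smul_add, Matrix.mulVec, dotProduct, Matrix.of_apply,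
      Finset.smul_sum, add_mul, Finset.sum_add_distrib, ite_mul, one_mul, zero_mul,
      Finset.sum_ite_eq, Finset.mem_univ, if_true, Int.cast_add, Int.cast_sum, Int.cast_mul,
      add_smul, Finset.sum_smul, smul_smul]
    congr 1
    rw [Finset.sum_comm]
    simp only [mul_comm]

end Filiform

/-! ### Splittings, and lattices through invariant measures. -/

/-- If the powers of `g ∈ Γ` represent the cosets of the normal subgroup `H` that meet `Γ`, each
once, then `Γ` is the semidirect product of `Γ ⊓ H` and the group generated by `g`. -/
theorem exists_semidirectProduct {G : Type*} [Group G] (Γ H : Subgroup G) [hH : H.Normal] {g : G}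
    (hg : g ∈ Γ) (hgen : ∀ x ∈ Γ, ∃ k : ℤ, x * (g ^ k)⁻¹ ∈ H)
    (hinj : ∀ k : ℤ, g ^ k ∈ H → k = 0) :
    ∃ (φ : Multiplicative ℤ →* MulAut ↥(Γ ⊓ H))
      (e : Γ ≃* SemidirectProduct ↥(Γ ⊓ H) (Multiplicative ℤ) φ),
      (∀ x : ↥(Γ ⊓ H), (φ (Multiplicative.ofAdd 1) x : G) = g * x * g⁻¹) ∧
      (∀ x : ↥(Γ ⊓ H), e ⟨x, x.2.1⟩ = SemidirectProduct.inl x) := by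
  have hconj : ∀ (y : Γ) (x : ↥(Γ ⊓ H)), (y : G) * x * (y : G)⁻¹ ∈ Γ ⊓ H := fun y x =>
    ⟨Γ.mul_mem (Γ.mul_mem y.2 x.2.1) (Γ.inv_mem y.2), hH.conj_mem _ x.2.2 _⟩
  let c : Γ →* MulAut ↥(Γ ⊓ H) :=
    { toFun := fun y =>
        { toFun := fun x => ⟨y * x * (y : G)⁻¹, hconj y x⟩
          invFun := fun x => ⟨(y⁻¹ : Γ) * x * ((y⁻¹ : Γ) : G)⁻¹, hconj y⁻¹ x⟩
          left_inv := fun x => Subtype.ext (by simp [mul_assoc])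
          right_inv := fun x => Subtype.ext (by simp [mul_assoc])
          map_mul' := fun x z => Subtype.ext (by simp [mul_assoc]) }
      map_one' := by ext x; simp
      map_mul' := fun y z => by ext x; simp [mul_assoc] }
  let z : Multiplicative ℤ →* Γ := zpowersHom Γ ⟨g, hg⟩
  have hz : ∀ k : Multiplicative ℤ, (z k : G) = g ^ (Multiplicative.toAdd k) := fun k => rfl
  let f : SemidirectProduct ↥(Γ ⊓ H) (Multiplicative ℤ) (c.comp z) →* Γ :=
    SemidirectProduct.lift (Subgroup.inclusion inf_le_left) z (fun k => by
      ext x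
      rfl)
  have hf : ∀ x, (f x : G) = x.left * g ^ (Multiplicative.toAdd x.right) := fun x => rfl
  have hbij : Function.Bijective f := by
    constructor
    · rw [injective_iff_map_eq_one]
      intro x hx
      have h1 : (x.left : G) * g ^ (Multiplicative.toAdd x.right) = 1 := by
        rw [← hf, hx]; rfl
      have h2 : Multiplicative.toAdd x.right = 0 := by
        apply hinj
        rw [eq_inv_of_mul_eq_one_right h1]
        exact H.inv_mem x.left.2.2
      rw [h2, zpow_zero, mul_one] at h1
      exact SemidirectProduct.ext (Subtype.ext h1) h2
    · intro x
      obtain ⟨k, hk⟩ := hgen x x.2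
      refine ⟨⟨⟨x * (g ^ k)⁻¹, Γ.mul_mem x.2 (Γ.inv_mem (Γ.zpow_mem hg k)), hk⟩,
        Multiplicative.ofAdd k⟩, Subtype.ext ?_⟩
      rw [hf]
      simp
  refine ⟨c.comp z, (MulEquiv.ofBijective f hbij).symm, fun x => ?_, fun x => ?_⟩
  · change (z (Multiplicative.ofAdd 1) : G) * x * (z (Multiplicative.ofAdd 1) : G)⁻¹ = _
    rw [hz]
    simp
  · rw [MulEquiv.symm_apply_eq]
    apply Subtype.ext
    change (x : G) = f _
    rw [hf]
    simp

/-- A discrete cocompact normal subgroup is a lattice. -/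
theorem isGroupLattice_of_compactSpace_quotient {G : Type*} [Group G] [TopologicalSpace G]
    [IsTopologicalGroup G] (N : Subgroup G) [N.Normal] [DiscreteTopology N] [CompactSpace (G ⧸ N)] :
    IsGroupLattice N := by
  refine ⟨inferInstance, ?_⟩
  let _ : MeasurableSpace (G ⧸ N) := borel (G ⧸ N)
  have : BorelSpace (G ⧸ N) := ⟨rfl⟩
  -- Haar measure of the compact quotient group, normalized to give the whole group mass one.
  refine ⟨MeasureTheory.Measure.haarMeasure ⊤, inferInstance, ?_, fun g => ?_⟩
  · intro h
    have := MeasureTheory.Measure.haarMeasure_self (G := G ⧸ N) (K₀ := ⊤)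
    rw [h] at this
    simp at this
  · have h : (fun x : G ⧸ N => g • x) = fun x => (g : G ⧸ N) * x := by
      funext x
      induction x using QuotientGroup.induction_on
      rfl
    rw [h]
    exact MeasureTheory.map_mul_left_eq_self _ _

/-- A lattice is not contained in the kernel of a continuous surjective homomorphism to `ℝ`. -/
theorem IsGroupLattice.not_le_ker {G : Type*} [Group G] [TopologicalSpace G]
    [IsTopologicalGroup G] {Γ : Subgroup G} (hΓ : IsGroupLattice Γ) (χ : G →* Multiplicative ℝ)
    (hc : Continuous χ) (hs : Function.Surjective χ) : ¬ Γ ≤ χ.ker := by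
  intro hle
  obtain ⟨-, μ, hfin, hμ, hinv⟩ := hΓ
  let _ : MeasurableSpace (G ⧸ Γ) := borel (G ⧸ Γ)
  have : BorelSpace (G ⧸ Γ) := ⟨rfl⟩
  -- Since χ is trivial on Γ it descends to an equivariant map to ℝ, along which μ is pushed
  -- forward.
  let f : G ⧸ Γ → ℝ := fun q => Quotient.liftOn' q (fun x => Multiplicative.toAdd (χ x))
    fun a b hab => by
      have h1 : χ (a⁻¹ * b) = 1 := hle (QuotientGroup.leftRel_apply.mp hab)
      rw [map_mul, map_inv, inv_mul_eq_one] at h1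
      simp only [h1]
  have hfc : Continuous f := Continuous.quotient_liftOn' hc _
  have hfs : ∀ (g : G) (x : G ⧸ Γ), f (g • x) = Multiplicative.toAdd (χ g) + f x := by
    intro g x
    induction x using QuotientGroup.induction_on with
    | H x => exact congrArg Multiplicative.toAdd (map_mul χ g x)
  have hν : MeasureTheory.Measure.IsAddLeftInvariant (μ.map f) := by
    refine ⟨fun t => ?_⟩
    obtain ⟨g, hg⟩ := hs (Multiplicative.ofAdd t)
    have hsm : Measurable fun x : G ⧸ Γ => g • x := (continuous_const_smul g).measurable
    have h1 : (fun s => t + s) ∘ f = f ∘ fun x => g • x := by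
      funext x
      simp [hfs, hg]
    rw [MeasureTheory.Measure.map_map (measurable_const_add t) hfc.measurable, h1,
      ← MeasureTheory.Measure.map_map hfc.measurable hsm, hinv g]
  have hne : μ.map f ≠ 0 := by
    rwa [Ne, MeasureTheory.Measure.map_eq_zero_iff hfc.measurable.aemeasurable]
  have : MeasureTheory.IsFiniteMeasure (μ.map f) := MeasureTheory.Measure.isFiniteMeasure_map μ f
  have : NeZero (μ.map f) := ⟨hne⟩
  have : (μ.map f).IsOpenPosMeasure :=
    MeasureTheory.isOpenPosMeasure_of_addLeftInvariant_of_regular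
  -- A nonzero translation-invariant measure on the noncompact group ℝ has infinite mass.
  exact MeasureTheory.measure_ne_top (μ.map f) Set.univ
    (MeasureTheory.measure_univ_of_isAddLeftInvariant _)

/-! ### The abelianization plane, and a compactness criterion. -/

namespace Filiform
variable {n : ℕ}

/-- The homomorphism `(v, t) ↦ α v₁ + β t`. -/
def character (hn : 0 < n) (α β : ℝ) : Filiform n →* Multiplicative ℝ where
  toFun x := Multiplicative.ofAdd (α * x.1 ⟨0, hn⟩ + β * x.2)
  map_one' := by simp [fst_one, snd_one]
  map_mul' x y := by
    rw [← ofAdd_add, fst_mul, snd_mul, Pi.add_apply,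
      flow_mulVec_apply x.2 (tail_zero y.1) ⟨0, hn⟩ le_rfl]
    congr 1
    ring

theorem character_apply (hn : 0 < n) (α β : ℝ) (x : Filiform n) :
    character hn α β x = Multiplicative.ofAdd (α * x.1 ⟨0, hn⟩ + β * x.2) := rfl

theorem continuous_character (hn : 0 < n) (α β : ℝ) : Continuous (character hn α β) :=
  (continuous_const.mul ((continuous_apply _).comp continuous_val_fst)).add
    (continuous_const.mul continuous_val_snd)

theorem character_surjective (hn : 0 < n) {α β : ℝ} (h : α ≠ 0 ∨ β ≠ 0) :
    Function.Surjective (character hn α β) := by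
  intro s
  rcases h with h | h
  · exact ⟨mk (Pi.single ⟨0, hn⟩ (Multiplicative.toAdd s / α)) 0, by
      rw [character_apply]; simp [mul_div_cancel₀ _ h]⟩
  · exact ⟨mk 0 (Multiplicative.toAdd s / β), by
      rw [character_apply]; simp [mul_div_cancel₀ _ h]⟩

/-- The images of a lattice in the abelianization of `F_n` span the plane. -/
theorem exists_noncollinear (hn : 0 < n) {Γ : Subgroup (Filiform n)} (hΓ : IsGroupLattice Γ) :
    ∃ x ∈ Γ, ∃ y ∈ Γ, x.2 * y.1 ⟨0, hn⟩ - y.2 * x.1 ⟨0, hn⟩ ≠ 0 := by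
  have h : ∀ α β : ℝ, α ≠ 0 ∨ β ≠ 0 → ∃ x ∈ Γ, α * x.1 ⟨0, hn⟩ + β * x.2 ≠ 0 := by
    intro α β hαβ
    by_contra! h
    exact hΓ.not_le_ker _ (continuous_character hn α β) (character_surjective hn hαβ)
      fun x hx => by
        rw [MonoidHom.mem_ker, character_apply, h x hx]; rfl
  obtain ⟨x, hx, hx0⟩ := h 0 1 (Or.inr one_ne_zero)
  -- This character is chosen to vanish at x; its value at y is the determinant sought.
  obtain ⟨y, hy, hy0⟩ := h x.2 (-x.1 ⟨0, hn⟩) (Or.inl (by simpa using hx0))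
  exact ⟨x, hx, y, hy, fun e => hy0 (by linarith)⟩

end Filiform

/-- The unit cube in the basis b maps onto the quotient: replacing coordinates by their fractional
parts changes a vector only by an integral combination of the `b j`. -/
theorem compactSpace_quotient_of_linearIndependent {G : Type*} [Group G] [TopologicalSpace G]
    {n : ℕ} (N : Subgroup G) (ψ : Multiplicative (Fin n → ℝ) →* G) (hc : Continuous ψ)
    (hs : Function.Surjective ψ) {b : Fin n → Fin n → ℝ} (hb : LinearIndependent ℝ b)
    (hN : ∀ j, ψ (Multiplicative.ofAdd (b j)) ∈ N) : CompactSpace (G ⧸ N) := by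
  let F : (Fin n → ℝ) → G ⧸ N := fun c => (ψ (Multiplicative.ofAdd (∑ k, c k • b k)) : G ⧸ N)
  have hF : Continuous F := QuotientGroup.continuous_mk.comp (hc.comp
    (show Continuous fun c : Fin n → ℝ => ∑ k, c k • b k by fun_prop))
  have hK : IsCompact (F '' Set.pi Set.univ fun _ => Set.Icc (0 : ℝ) 1) :=
    (isCompact_univ_pi fun _ => isCompact_Icc).image hF
  refine ⟨hK.of_isClosed_subset isClosed_univ fun q _ => ?_⟩
  induction q using QuotientGroup.induction_on with
  | H x =>
    obtain ⟨w, rfl⟩ := hs x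
    let B := basisOfLinearIndependentOfCardEqFinrank' b hb (by simp)
    let r := B.repr (Multiplicative.toAdd w)
    have hr : ∑ k, r k • b k = Multiplicative.toAdd w := by
      have hB : ⇑B = b := coe_basisOfLinearIndependentOfCardEqFinrank' b hb (by simp)
      rw [← hB]
      exact B.sum_repr _
    refine ⟨fun k => Int.fract (r k), fun k _ => ⟨Int.fract_nonneg _, (Int.fract_lt_one _).le⟩, ?_⟩
    refine QuotientGroup.eq.mpr ?_
    rw [← map_inv, ← map_mul]
    have h1 : (Multiplicative.ofAdd (∑ k, Int.fract (r k) • b k))⁻¹ * w =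
        ∏ k, Multiplicative.ofAdd (b k) ^ ⌊r k⌋ := by
      apply Multiplicative.toAdd.injective
      simp only [toAdd_mul, toAdd_inv, toAdd_ofAdd, toAdd_prod, toAdd_zpow]
      rw [← hr, neg_add_eq_sub, ← Finset.sum_sub_distrib]
      refine Finset.sum_congr rfl fun k _ => ?_
      rw [← sub_smul, Int.self_sub_fract, Int.cast_smul_eq_zsmul]
    rw [h1]
    exact Subgroup.prod_mem (N.comap ψ) fun k _ =>
      Subgroup.zpow_mem (N.comap ψ) (hN k) _

/-! ### Transport by automorphisms, and the structure of Γ. -/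

namespace Filiform
variable {n : ℕ}

theorem symm_mk_mem (Φ : Filiform n ≃ₜ* Filiform n) (v : Fin n → ℝ) :
    Φ.symm (mk v 0) ∈ (horizontal n).comap Φ.toMulEquiv.toMonoidHom := by
  change (Φ (Φ.symm _)).2 = 0
  rw [ContinuousMulEquiv.apply_symm_apply, mk_snd]

/-- The preimage of `H_n` under an automorphism of `F_n` is isomorphic to `ℝⁿ`. -/
def comapHorizontalEquiv (Φ : Filiform n ≃ₜ* Filiform n) :
    (horizontal n).comap Φ.toMulEquiv.toMonoidHom ≃ₜ* Multiplicative (Fin n → ℝ) where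
  toFun x := Multiplicative.ofAdd (Φ x).1
  invFun v := ⟨Φ.symm (mk (Multiplicative.toAdd v) 0), symm_mk_mem Φ _⟩
  left_inv x := Subtype.ext (by
    have hx : (Φ x).2 = 0 := x.2
    change Φ.symm (mk (Φ x).1 0) = x
    rw [← hx]
    exact Φ.symm_apply_apply x)
  right_inv v := by
    change Multiplicative.ofAdd (Φ (Φ.symm _)).1 = v
    rw [ContinuousMulEquiv.apply_symm_apply, mk_fst, ofAdd_toAdd]
  map_mul' x y := by
    have hx : (Φ x).2 = 0 := x.2
    simp only [Subgroup.coe_mul, map_mul, fst_mul, hx, flow_zero, Matrix.one_mulVec, ofAdd_add]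
  continuous_toFun := continuous_val_fst.comp (Φ.continuous.comp continuous_subtype_val)
  continuous_invFun :=
    (Φ.symm.continuous.comp
      (continuous_mk.comp (continuous_id.prodMk continuous_const))).subtype_mk _

theorem maximal_comap_horizontal (hn : 2 ≤ n) (Φ : Filiform n ≃ₜ* Filiform n) :
    Maximal (fun K : Subgroup (Filiform n) => K.Normal ∧ IsMulCommutative K)
      ((horizontal n).comap Φ.toMulEquiv.toMonoidHom) := by
  refine ⟨⟨inferInstance, ⟨⟨fun x y => ?_⟩⟩⟩, ?_⟩
  · apply (comapHorizontalEquiv Φ).injective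
    rw [map_mul, map_mul, mul_comm]
  · rintro K ⟨hK, hc⟩ hle
    have hnorm : (K.map Φ.toMulEquiv.toMonoidHom).Normal := hK.map _ Φ.surjective
    have hcomm : IsMulCommutative (K.map Φ.toMulEquiv.toMonoidHom) := by
      refine ⟨⟨?_⟩⟩
      rintro ⟨_, x, hx, rfl⟩ ⟨_, y, hy, rfl⟩
      apply Subtype.ext
      have h : x * y = y * x := congrArg Subtype.val (hc.is_comm.comm (⟨x, hx⟩ : K) ⟨y, hy⟩)
      change Φ x * Φ y = Φ y * Φ x
      rw [← map_mul, h, map_mul]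
    have h := (maximal_horizontal hn).2 ⟨hnorm, hcomm⟩ (fun y hy => by
      refine ⟨Φ.symm y, hle ?_, Φ.apply_symm_apply y⟩
      change Φ (Φ.symm y) ∈ horizontal n
      rwa [Φ.apply_symm_apply])
    exact fun x hx => h ⟨x, hx, rfl⟩

/-- The vectors of `Φ(Γ) ∩ H_n`, as the subgroup `Γ ∩ Φ⁻¹(H_n)`. -/
def infComapEquiv (Φ : Filiform n ≃ₜ* Filiform n) (Γ : Subgroup (Filiform n)) :
    ↥(Γ ⊓ (horizontal n).comap Φ.toMulEquiv.toMonoidHom) ≃*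
      Multiplicative (vectors (Γ.map Φ.toMulEquiv.toMonoidHom)) where
  toFun x := Multiplicative.ofAdd ⟨(Φ x).1, x, x.2.1, by
    have hx : (Φ x).2 = 0 := x.2.2
    exact ext' rfl hx⟩
  invFun v := ⟨Φ.symm (mk (Multiplicative.toAdd v).1 0), by
    obtain ⟨x, hx, h⟩ := (Multiplicative.toAdd v).2
    rw [← h]
    change Φ.symm (Φ x) ∈ Γ
    rwa [Φ.symm_apply_apply], symm_mk_mem Φ _⟩
  left_inv x := Subtype.ext (by
    have hx : (Φ x).2 = 0 := x.2.2
    change Φ.symm (mk (Φ x).1 0) = x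
    rw [← hx]
    exact Φ.symm_apply_apply _)
  right_inv v := by
    apply Multiplicative.toAdd.injective
    apply Subtype.ext
    change (Φ (Φ.symm _)).1 = _
    rw [ContinuousMulEquiv.apply_symm_apply, mk_fst]
  map_mul' x y := by
    have hx : (Φ x).2 = 0 := x.2.2
    apply Multiplicative.toAdd.injective
    apply Subtype.ext
    change (Φ (x * y)).1 = (Φ x).1 + (Φ y).1
    rw [map_mul, fst_mul, hx, flow_zero, Matrix.one_mulVec]

theorem infComapEquiv_apply (Φ : Filiform n ≃ₜ* Filiform n) (Γ : Subgroup (Filiform n))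
    (x : ↥(Γ ⊓ (horizontal n).comap Φ.toMulEquiv.toMonoidHom)) :
    (Multiplicative.toAdd (infComapEquiv Φ Γ x)).1 = (Φ x).1 := rfl

theorem discreteTopology_map (Φ : Filiform n ≃ₜ* Filiform n) (Γ : Subgroup (Filiform n))
    [DiscreteTopology Γ] : DiscreteTopology (Γ.map Φ.toMulEquiv.toMonoidHom) := by
  let f : Γ.map Φ.toMulEquiv.toMonoidHom → Γ := fun y => ⟨Φ.symm y, by
    obtain ⟨_, x, hx, rfl⟩ := y
    change Φ.symm (Φ x) ∈ Γ
    rwa [Φ.symm_apply_apply]⟩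
  refine DiscreteTopology.of_continuous_injective (f := f)
    ((Φ.symm.continuous.comp continuous_subtype_val).subtype_mk _) fun x y h => ?_
  exact Subtype.ext (Φ.symm.injective (congrArg Subtype.val h))

/-- The structure of a discrete subgroup `Γ` for which `Φ(Γ) ∩ H_n` is large. -/
theorem structure_of_discrete (hn : 2 ≤ n) (Φ : Filiform n ≃ₜ* Filiform n)
    (Γ : Subgroup (Filiform n)) [DiscreteTopology Γ]
    (hv : ∃ v ∈ vectors (Γ.map Φ.toMulEquiv.toMonoidHom), v ⟨0, by omega⟩ ≠ 0)
    (ht : ∃ x ∈ Γ, (Φ x).2 ≠ 0) {H : Subgroup (Filiform n)}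
    (hH : H = (horizontal n).comap Φ.toMulEquiv.toMonoidHom) :
    Maximal (fun K : Subgroup (Filiform n) => K.Normal ∧ IsMulCommutative K) H ∧
    Nonempty (H ≃ₜ* Multiplicative (Fin n → ℝ)) ∧
    (∃ p : Filiform n →* Multiplicative ℝ,
      Continuous p ∧ Function.Surjective p ∧ p.ker = H) ∧
    IsGroupLattice (Γ.subgroupOf H) ∧
    ∃ (β : ↥(Γ ⊓ H) ≃* Multiplicative (Fin n → ℤ)) (A : Matrix (Fin n) (Fin n) ℤ)
      (φ : Multiplicative ℤ →* MulAut ↥(Γ ⊓ H))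
      (e : Γ ≃* SemidirectProduct ↥(Γ ⊓ H) (Multiplicative ℤ) φ),
      (∀ k, A k k = 1) ∧ (∀ k l, k < l → A k l = 0) ∧
      (∀ x : ↥(Γ ⊓ H), β (φ (Multiplicative.ofAdd 1) x) =
        Multiplicative.ofAdd (A.mulVec (Multiplicative.toAdd (β x)))) ∧
      (∀ x : ↥(Γ ⊓ H), e ⟨x, x.2.1⟩ = SemidirectProduct.inl x) := by
  subst hH
  have hdisc := discreteTopology_map Φ Γ
  obtain ⟨v, hv, hv0⟩ := hv
  obtain ⟨x₀, hx₀, hx₀t⟩ := ht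
  -- The vector v is moved by every nonzero height, so the heights are cyclic; g realizes a
  -- generator and will generate the factor ℤ.
  obtain ⟨_, ⟨g, hg, rfl⟩, hgen⟩ := exists_height_generator _ hv (tail_zero v) hv0
    (by simp only; omega)
  replace hgen : ∀ x ∈ Γ, ∃ k : ℤ, (Φ x).2 = k * (Φ g).2 := fun x hx => hgen _ ⟨x, hx, rfl⟩
  have hgt : (Φ g).2 ≠ 0 := by
    intro h
    obtain ⟨k, hk⟩ := hgen x₀ hx₀
    exact hx₀t (by rw [hk, h, mul_zero])
  have hflow : ∀ v ∈ vectors (Γ.map Φ.toMulEquiv.toMonoidHom),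
      (flow n (Φ g).2).mulVec v ∈ vectors (Γ.map Φ.toMulEquiv.toMonoidHom) := fun v hv =>
    flow_mem_vectors (Subgroup.mem_map_of_mem _ hg) hv
  obtain ⟨ε, hε, hsmall⟩ := exists_norm_lt_imp_eq_zero (Γ.map Φ.toMulEquiv.toMonoidHom)
  obtain ⟨b, hb, hbΛ, hbgen⟩ :=
    exists_adapted_basis hε hsmall hgt hflow (by omega) hv hv0
  obtain ⟨A, hA1, hA0, hA⟩ := exists_unipotent_matrix hb hbΛ hbgen hflow
  have hmax := maximal_comap_horizontal hn Φ
  refine ⟨hmax, ⟨comapHorizontalEquiv Φ⟩,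
    ⟨(height n).comp Φ.toMulEquiv.toMonoidHom, continuous_height.comp Φ.continuous,
      height_surjective.comp Φ.surjective, by rw [← MonoidHom.comap_ker, height_ker]⟩, ?_, ?_⟩
  · have hnorm : (Γ.subgroupOf ((horizontal n).comap Φ.toMulEquiv.toMonoidHom)).Normal :=
      ⟨fun x hx y => by rwa [hmax.1.2.is_comm.comm y x, mul_inv_cancel_right]⟩
    have hd : DiscreteTopology (Γ.subgroupOf ((horizontal n).comap Φ.toMulEquiv.toMonoidHom)) :=
      DiscreteTopology.of_continuous_injective
        (f := fun x => (⟨x.1.1, x.2⟩ : Γ))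
        ((continuous_subtype_val.comp continuous_subtype_val).subtype_mk _)
        fun x y h => Subtype.ext (Subtype.ext (congrArg (fun z : Γ => z.1) h))
    have : CompactSpace (_ ⧸ Γ.subgroupOf ((horizontal n).comap Φ.toMulEquiv.toMonoidHom)) :=
      compactSpace_quotient_of_linearIndependent _
        (comapHorizontalEquiv Φ).symm.toMulEquiv.toMonoidHom
        (comapHorizontalEquiv Φ).symm.continuous (comapHorizontalEquiv Φ).symm.surjective
        hb.linearIndependent fun j =>
          ((infComapEquiv Φ Γ).symm (Multiplicative.ofAdd ⟨b j, hbΛ j⟩)).2.1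
    exact isGroupLattice_of_compactSpace_quotient _
  · obtain ⟨φ, e, hφ, he⟩ := exists_semidirectProduct Γ
      ((horizontal n).comap Φ.toMulEquiv.toMonoidHom) hg (fun x hx => by
        obtain ⟨k, hk⟩ := hgen x hx
        refine ⟨k, ?_⟩
        change (Φ (x * (g ^ k)⁻¹)).2 = 0
        rw [map_mul, map_inv, map_zpow, snd_mul, snd_inv, snd_zpow, hk, add_neg_cancel])
      (fun k hk => by
        have h : (Φ (g ^ k)).2 = 0 := hk
        rw [map_zpow, snd_zpow] at h
        simpa [hgt] using h)
    have hmem : ∀ c, intComb b c ∈ vectors (Γ.map Φ.toMulEquiv.toMonoidHom) := fun c => by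
      rw [intComb_apply]
      refine AddSubgroup.sum_mem _ fun k _ => ?_
      rw [Int.cast_smul_eq_zsmul]
      exact AddSubgroup.zsmul_mem _ (hbΛ k) _
    let E : (Fin n → ℤ) ≃+ vectors (Γ.map Φ.toMulEquiv.toMonoidHom) :=
      AddEquiv.ofBijective ((intComb b).codRestrict _ hmem)
        ⟨fun c d h => hb.intComb_injective (congrArg Subtype.val h), fun w => by
          obtain ⟨c, hc⟩ := exists_intComb_eq hb hbΛ hbgen w.2
          exact ⟨c, Subtype.ext hc⟩⟩
    have hE : ∀ c, (E c : Fin n → ℝ) = intComb b c := fun c => rfl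
    let β := (infComapEquiv Φ Γ).trans E.symm.toMultiplicative
    have hβ : ∀ x, intComb b (Multiplicative.toAdd (β x)) = (Φ x).1 := fun x => by
      rw [← hE, ← infComapEquiv_apply]
      exact congrArg Subtype.val (E.apply_symm_apply (Multiplicative.toAdd (infComapEquiv Φ Γ x)))
    refine ⟨β, A, φ, e, hA1, hA0, fun x => ?_, he⟩
    apply Multiplicative.toAdd.injective
    apply hb.intComb_injective
    rw [toAdd_ofAdd, ← hA, hβ, hβ, hφ]
    have hx : Φ x = mk (Φ x).1 0 := ext' rfl x.2.2
    rw [map_mul, map_mul, map_inv, hx, conj_mk_zero, mk_fst, mk_fst]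

/-! ### Finding a horizontal vector with nonzero first coordinate. -/

theorem fst_zpow_zero (hn : 0 < n) (x : Filiform n) (k : ℤ) :
    (x ^ k).1 ⟨0, hn⟩ = k * x.1 ⟨0, hn⟩ := by
  have := map_zpow (character hn 1 0) x k
  simpa [character_apply, ← ofAdd_zsmul] using this

theorem fst_mul_zero (hn : 0 < n) (x y : Filiform n) :
    (x * y).1 ⟨0, hn⟩ = x.1 ⟨0, hn⟩ + y.1 ⟨0, hn⟩ := by
  rw [fst_mul, Pi.add_apply, flow_mulVec_apply x.2 (tail_zero y.1) ⟨0, hn⟩ le_rfl]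

theorem fst_inv_zero (hn : 0 < n) (x : Filiform n) : x⁻¹.1 ⟨0, hn⟩ = -x.1 ⟨0, hn⟩ := by
  rw [fst_inv, Pi.neg_apply, flow_mulVec_apply _ (tail_zero x.1) ⟨0, hn⟩ le_rfl]

/-- The commutator of x and y has second coordinate equal to the given determinant. For n ≥ 3 that
is not the last coordinate, so the heights are generated by that of some g. If every horizontal
vector had v₁ = 0, each z ∈ Γ would agree with a power of g in the plane, making x and y collinear.
-/
theorem exists_mem_vectors (hn : 3 ≤ n) {Γ : Subgroup (Filiform n)} [DiscreteTopology Γ]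
    (h : ∃ x ∈ Γ, ∃ y ∈ Γ, x.2 * y.1 ⟨0, by omega⟩ - y.2 * x.1 ⟨0, by omega⟩ ≠ 0) :
    ∃ v ∈ vectors Γ, v ⟨0, by omega⟩ ≠ 0 := by
  obtain ⟨x, hx, y, hy, hxy⟩ := h
  by_contra! hv
  have hc : x * y * (y * x)⁻¹ ∈ Γ := Γ.mul_mem (Γ.mul_mem hx hy) (Γ.inv_mem (Γ.mul_mem hy hx))
  rw [commutator_eq] at hc
  obtain ⟨g, hg, hgen⟩ := exists_height_generator Γ hc (j := ⟨1, by omega⟩)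
    ((tail n 1).sub_mem (flow_mulVec_sub_mem _ (tail_zero _))
      (flow_mulVec_sub_mem _ (tail_zero _)))
    (by
      have h1 := flow_mulVec_sub_apply x.2 (j := ⟨0, by omega⟩) (tail_zero y.1)
        (by simp only; omega)
      have h2 := flow_mulVec_sub_apply y.2 (j := ⟨0, by omega⟩) (tail_zero x.1)
        (by simp only; omega)
      simp only [zero_add] at h1 h2
      rw [Pi.sub_apply, h1, h2]
      exact hxy)
    (by simp only; omega)
  have key : ∀ z ∈ Γ, ∃ k : ℤ, z.2 = k * g.2 ∧ z.1 ⟨0, by omega⟩ = k * g.1 ⟨0, by omega⟩ := by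
    intro z hz
    obtain ⟨k, hk⟩ := hgen z hz
    refine ⟨k, hk, ?_⟩
    have h1 : (z * (g ^ k)⁻¹).2 = 0 := by
      rw [snd_mul, snd_inv, snd_zpow, hk, add_neg_cancel]
    have h2 : mk (z * (g ^ k)⁻¹).1 0 ∈ Γ := by
      rw [← h1]
      exact Γ.mul_mem hz (Γ.inv_mem (Γ.zpow_mem hg k))
    have h3 := hv _ h2
    rw [fst_mul_zero, fst_inv_zero, fst_zpow_zero] at h3
    linarith
  obtain ⟨k, hk1, hk2⟩ := key x hx
  obtain ⟨l, hl1, hl2⟩ := key y hy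
  apply hxy
  rw [hk1, hk2, hl1, hl2]
  ring

/-- Finite index puts a positive power of (e₁, 0) into Γ. -/
theorem exists_mem_vectors_of_commensurable (hn : 0 < n) {Γ : Subgroup (Filiform n)}
    (h : Γ.Commensurable (integerLattice n)) : ∃ v ∈ vectors Γ, v ⟨0, hn⟩ ≠ 0 := by
  let x : Filiform n := mk (fun i : Fin n => if (i : ℕ) = 0 then (1 : ℝ) else 0) 0
  have hx : x ∈ integerLattice n := Subgroup.subset_closure (Or.inl rfl)
  obtain ⟨k, hk, -, hkm⟩ := Subgroup.exists_pow_mem_of_relIndex_ne_zero h.1 hx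
  rw [← zpow_natCast] at hkm
  have h1 : (x ^ (k : ℤ)).2 = 0 := by rw [snd_zpow, mk_snd, mul_zero]
  have hmem : mk (x ^ (k : ℤ)).1 0 ∈ Γ := by
    rw [← h1]
    exact hkm.1
  refine ⟨_, hmem, ?_⟩
  rw [fst_zpow_zero]
  simpa [x] using hk.ne'

/-! ### The Heisenberg case n = 2. -/

theorem fst_mul_two (x y : Filiform 2) :
    (x * y).1 0 = x.1 0 + y.1 0 ∧ (x * y).1 1 = x.1 1 + (y.1 1 + x.2 * y.1 0) :=
  ⟨fst_mul_zero two_pos x y, congrArg (x.1 1 + ·)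
    (flow_mulVec_apply_succ x.2 (j := 0) (tail_zero y.1) one_lt_two)⟩

/-- An automorphism of the Heisenberg group `F_2` that acts on the plane
`F_2 / [F_2, F_2]` by `(x, t) ↦ (t, x + δ t)`. -/
def shearSwap (δ : ℝ) : Filiform 2 ≃ₜ* Filiform 2 where
  -- The swap reverses the orientation of the plane, hence the sign on the center. The quadratic
  -- terms v₁t and δt²/2 compensate for the product being non-symmetric in these coordinates.
  toFun x := mk ![x.2, -x.1 1 + x.1 0 * x.2 + δ * x.2 ^ 2 / 2] (x.1 0 + δ * x.2)
  invFun y := mk ![y.2 - δ * y.1 0, -y.1 1 + (y.2 - δ * y.1 0) * y.1 0 + δ * y.1 0 ^ 2 / 2] (y.1 0)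
  left_inv x := by
    apply ext'
    · funext i
      fin_cases i
      · simp
      · simp only [Fin.mk_one, mk_fst, mk_snd, Matrix.cons_val_zero, Matrix.cons_val_one]
        ring
    · simp
  right_inv y := by
    apply ext'
    · funext i
      fin_cases i
      · simp
      · simp only [Fin.mk_one, mk_fst, mk_snd, Matrix.cons_val_zero, Matrix.cons_val_one]
        ring
    · simp
  map_mul' x y := by
    obtain ⟨h0, h1⟩ := fst_mul_two x y
    apply ext'
    · funext i
      fin_cases i
      · refine Eq.trans ?_ (fst_mul_two _ _).1.symm
        simp [snd_mul]
      · refine Eq.trans ?_ (fst_mul_two _ _).2.symm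
        simp [h0, h1, snd_mul]
        ring
    · simp only [mk_snd, snd_mul, h0]
      ring
  continuous_toFun := by
    have h0 : Continuous fun x : Filiform 2 => x.1 0 := (continuous_apply _).comp continuous_val_fst
    have h1 : Continuous fun x : Filiform 2 => x.1 1 := (continuous_apply _).comp continuous_val_fst
    have h2 := continuous_val_snd (n := 2)
    refine continuous_mk.comp (Continuous.prodMk (continuous_pi fun i => ?_) (by fun_prop))
    fin_cases i
    · exact h2
    · exact ((h1.neg.add (h0.mul h2)).add ((continuous_const.mul (h2.pow 2)).div_const 2))
  continuous_invFun := by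
    have h0 : Continuous fun x : Filiform 2 => x.1 0 := (continuous_apply _).comp continuous_val_fst
    have h1 : Continuous fun x : Filiform 2 => x.1 1 := (continuous_apply _).comp continuous_val_fst
    have h2 := continuous_val_snd (n := 2)
    refine continuous_mk.comp (Continuous.prodMk (continuous_pi fun i => ?_) (by fun_prop))
    have h3 := h2.sub (continuous_const (y := δ).mul h0)
    fin_cases i
    · exact h3
    · exact ((h1.neg.add (h3.mul h0)).add ((continuous_const.mul (h0.pow 2)).div_const 2))

theorem shearSwap_snd (δ : ℝ) (x : Filiform 2) : (shearSwap δ x).2 = x.1 0 + δ * x.2 := rfl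

theorem exists_automorphism_two {Γ : Subgroup (Filiform 2)}
    (h : ∃ x ∈ Γ, ∃ y ∈ Γ, x.2 * y.1 0 - y.2 * x.1 0 ≠ 0) :
    ∃ Φ : Filiform 2 ≃ₜ* Filiform 2,
      (∃ v ∈ vectors (Γ.map Φ.toMulEquiv.toMonoidHom), v 0 ≠ 0) ∧ ∃ x ∈ Γ, (Φ x).2 ≠ 0 := by
  obtain ⟨x, hx, y, hy, hxy⟩ := h
  obtain ⟨a, ha, ha2⟩ : ∃ a ∈ Γ, a.2 ≠ 0 := by
    by_contra! h
    exact hxy (by rw [h x hx, h y hy, zero_mul, zero_mul, sub_zero])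
  have hΦa : (shearSwap (-a.1 0 / a.2) a).2 = 0 := by
    rw [shearSwap_snd, div_mul_cancel₀ _ ha2, add_neg_cancel]
  -- The shear parameter makes the image of a horizontal, and the swap makes its first coordinate
  -- a.2 ≠ 0. If all images were horizontal, the plane image of Γ would lie on a line.
  refine ⟨shearSwap (-a.1 0 / a.2), ⟨_, ⟨a, ha, ext' rfl hΦa⟩, ha2⟩, ?_⟩
  by_contra! h
  have h1 := h x hx
  have h2 := h y hy
  rw [shearSwap_snd] at h1 h2
  exact hxy (by linear_combination x.2 * h2 - y.2 * h1)

end Filiform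

end

theorem theorem3 (n : ℕ) (hn : 2 ≤ n) (Γ : Subgroup (Filiform n)) (hΓ : IsGroupLattice Γ) :
    ∃ H : Subgroup (Filiform n),
      -- `H` is a maximal abelian normal subgroup, isomorphic to `ℝⁿ`, with quotient `ℝ`
      Maximal (fun K : Subgroup (Filiform n) => K.Normal ∧ IsMulCommutative K) H ∧
      Nonempty (H ≃ₜ* Multiplicative (Fin n → ℝ)) ∧
      (∃ p : Filiform n →* Multiplicative ℝ,
        Continuous p ∧ Function.Surjective p ∧ p.ker = H) ∧
      -- for `n ≥ 3` it contains every abelian normal subgroup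
      (3 ≤ n → ∀ K : Subgroup (Filiform n), K.Normal → IsMulCommutative K → K ≤ H) ∧
      -- it is the subgroup `ℝⁿ × {0}`, except possibly for `n = 2`
      (3 ≤ n ∨ Γ.Commensurable (Filiform.integerLattice n) → H = Filiform.horizontal n) ∧
      -- `L = Γ ∩ H` is a lattice in `H`
      IsGroupLattice (Γ.subgroupOf H) ∧
      -- `β` is an ordered basis of `L`, in which the generator of `ℤ` acts by the matrix `A`
      ∃ (β : ↥(Γ ⊓ H) ≃* Multiplicative (Fin n → ℤ)) (A : Matrix (Fin n) (Fin n) ℤ)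
        (φ : Multiplicative ℤ →* MulAut ↥(Γ ⊓ H))
        (e : Γ ≃* SemidirectProduct ↥(Γ ⊓ H) (Multiplicative ℤ) φ),
        (∀ k, A k k = 1) ∧ (∀ k l, k < l → A k l = 0) ∧
        (∀ x : ↥(Γ ⊓ H), β (φ (Multiplicative.ofAdd 1) x) =
          Multiplicative.ofAdd (A.mulVec (Multiplicative.toAdd (β x)))) ∧
        (∀ x : ↥(Γ ⊓ H), e ⟨x, x.2.1⟩ = SemidirectProduct.inl x) := by
  have : DiscreteTopology Γ := hΓ.1
  have hnc := Filiform.exists_noncollinear (show 0 < n by omega) hΓ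
  -- If such a v exists, H_n itself works. Otherwise n = 2 and Γ is not commensurable with Γ₀, so
  -- the claims identifying H with H_n are vacuous.
  by_cases hv : ∃ v ∈ Filiform.vectors Γ, v ⟨0, by omega⟩ ≠ 0
  · have hid : Γ.map (ContinuousMulEquiv.refl (Filiform n)).toMulEquiv.toMonoidHom = Γ :=
      Γ.map_id
    have ht : ∃ x ∈ Γ, x.2 ≠ 0 := by
      obtain ⟨x, hx, y, hy, hxy⟩ := hnc
      by_contra! h
      exact hxy (by rw [h x hx, h y hy, zero_mul, zero_mul, sub_zero])
    obtain ⟨h1, h2, h3, h4, h5⟩ := Filiform.structure_of_discrete hn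
      (ContinuousMulEquiv.refl (Filiform n)) Γ (by rwa [hid]) ht (H := Filiform.horizontal n) rfl
    exact ⟨Filiform.horizontal n, h1, h2, h3, Filiform.le_horizontal_of_normal_comm,
      fun _ => rfl, h4, h5⟩
  · have hn3 : ¬ 3 ≤ n := fun h => hv (Filiform.exists_mem_vectors h hnc)
    have hcomm : ¬ Γ.Commensurable (Filiform.integerLattice n) := fun h =>
      hv (Filiform.exists_mem_vectors_of_commensurable (by omega) h)
    obtain rfl : n = 2 := by omega
    obtain ⟨Φ, hΦv, hΦt⟩ := Filiform.exists_automorphism_two hnc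
    obtain ⟨h1, h2, h3, h4, h5⟩ := Filiform.structure_of_discrete hn Φ Γ hΦv hΦt rfl
    exact ⟨_, h1, h2, h3, fun h => absurd h hn3, fun h => (h.elim hn3 hcomm).elim, h4, h5⟩
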